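/- Let $X$ be a uniformly locally finite metric space, i.e. a metric space such that for every $r>0$ the cardinalities of the balls of radius $r$ in $X$ are uniformly bounded. Let $\beta X$ be the space of ultrafilters on $X$, with the topology that has the sets $\{\xi : A\in\xi\}$ ($A\subseteq X$) as a basis. A partial translation of $X$ is a bijection $f:\mathrm{dom}(f)\to\mathrm{im}(f)$ between subsets of $X$ with $\sup_{x\in \mathrm{dom}(f)}d(x,f(x))<\infty$; if $\mathrm{dom}(f)\in\xi\in\beta X$, let $\overline f(\xi)=\{B\subseteq X : f^{-1}(B)\in\xi\}$ be the image ultrafilter. For $\xi\in\beta X$, let \[\mathrm{Orb}(\xi)=\{\overline f(\xi) : f \text{ a partial translation with } \mathrm{dom}(f)\in\xi\},\qquad \mathrm{q}\text{-}\mathrm{Orb}(\xi)=\{\eta\in\beta X : \overline{\mathrm{Orb}(\eta)}=\overline{\mathrm{Orb}(\xi)}\}.\] The orbits partition $\beta X$, and so do the quasi-orbits; let $\mathcal{O}rb(\beta X)$ and $q\text{-}\mathcal{O}rb(\beta X)$ be the sets of orbits and of quasi-orbits, with the quotient topologies from $\beta X$. Let $\mathrm{C}^*_u(X)\subseteq\mathcal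 B(\ell_2(X))$ be the uniform Roe algebra, the $\mathrm{C}^*$-algebra generated by the partial isometries $v_f$, $f$ a partial translation, where $v_f\delta_x=\delta_{f(x)}$ if $x\in\mathrm{dom}(f)$ and $v_f\delta_x=0$ otherwise. For $\xi\in\beta X$, let $\pi_\xi$ be the GNS representation of $\mathrm{C}^*_u(X)$ associated with the state $\varphi_\xi(a)=\lim_{x\to\xi}\langle a\delta_x,\delta_x\rangle$. Let $\mathrm{Prim}(\mathrm{C}^*_u(X))$ be the set of primitive ideals (kernels of irreducible representations on nonzero Hilbert spaces) of $\mathrm{C}^*_u(X)$ with the hull-kernel topology, and let $\mathrm{Irr}(\mathrm{C}^*_u(X))$ be the irreducible representations of $\mathrm{C}^*_u(X)$ modulo unitary equivalence, with the smallest topology that makes $[\pi]\mapsto\ker\pi\in\mathrm{Prim}(\mathrm{C}^*_u(X))$ continuous. Then every $\pi_\xi$ is irreducible, the maps \[\mathcal{O}rb(\beta X)\to\mathrm{Irr}(\mathrm{C}^*_u(X)),\quad \mathrm{Orb}(\xi)\mapsto[\pi_\xi],\qquad\text{and}\qquad q\text{-}\mathcal{O}rb(\beta X)\to\mathrm{Prim}(\mathrm{C}^*_u(X)),\quad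 \mathrm{q}\text{-}\mathrm{Orb}(\xi)\mapsto\ker\pi_\xi,\] are well defined, and each of them is a homeomorphism onto its image. -/

import Mathlib

open Filter Topology
open scoped ComplexOrder

universe u

namespace UniformRoe

noncomputable section

/-! ### Uniformly locally finite spaces, partial translations and orbits -/

/-- A metric space is uniformly locally finite if, for every `r`, the cardinality of the balls of
radius `r` is bounded. -/
def IsULF (X : Type u) [MetricSpace X] : Prop :=
  ∀ r : ℝ, ∃ N : ℕ, ∀ x : X, (Metric.closedBall x r).encard ≤ N

/-- A bijection `f : f.source → f.target` between subsets of `X` is a partial translation if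
`sup_{x ∈ f.source} d(x, f x) < ∞`. -/
def IsPartialTranslation {X : Type u} [MetricSpace X] (f : PartialEquiv X X) : Prop :=
  ∃ C : ℝ, ∀ x ∈ f.source, dist x (f x) ≤ C

/-- The orbit of a point `ξ` of `βX`, the space of ultrafilters on `X`. For `f.source ∈ ξ`, the
ultrafilter `ξ.map f` is the value at `ξ` of the Stone-Čech extension of `f`. -/
def Orb {X : Type u} [MetricSpace X] (ξ : Ultrafilter X) : Set (Ultrafilter X) :=
  {η | ∃ f : PartialEquiv X X, IsPartialTranslation f ∧ f.source ∈ ξ ∧ η = ξ.map f}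

variable {X : Type u} [MetricSpace X]

theorem mem_Orb_self (ξ : Ultrafilter X) : ξ ∈ Orb ξ :=
  ⟨PartialEquiv.refl X, ⟨0, fun x _ => by simp⟩, Filter.univ_mem, by
    rw [PartialEquiv.refl_coe, Ultrafilter.map_id]⟩

theorem mem_Orb_symm {ξ η : Ultrafilter X} (h : η ∈ Orb ξ) : ξ ∈ Orb η := by
  obtain ⟨f, ⟨C, hC⟩, hf, rfl⟩ := h
  refine ⟨f.symm, ⟨C, fun x hx => ?_⟩, ?_, ?_⟩
  · have h1 : f.symm x ∈ f.source := f.map_target hx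
    have h2 := hC _ h1
    rw [f.right_inv hx, dist_comm] at h2
    exact h2
  · rw [Ultrafilter.mem_map]
    exact Filter.mem_of_superset hf fun x hx => f.map_source hx
  · rw [Ultrafilter.map_map]
    apply Ultrafilter.coe_injective
    rw [Ultrafilter.coe_map]
    have h1 : (f.symm ∘ f) =ᶠ[(ξ : Filter X)] id :=
      Filter.mem_of_superset hf fun x hx => f.left_inv hx
    rw [Filter.map_congr h1, Filter.map_id]

theorem mem_Orb_trans {ξ η ζ : Ultrafilter X} (h : η ∈ Orb ξ) (h' : ζ ∈ Orb η) : ζ ∈ Orb ξ := by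
  obtain ⟨f, ⟨C, hC⟩, hf, rfl⟩ := h
  obtain ⟨g, ⟨D, hD⟩, hg, rfl⟩ := h'
  refine ⟨f.trans g, ⟨C + D, fun x hx => ?_⟩, ?_, ?_⟩
  · rw [PartialEquiv.trans_source] at hx
    exact (dist_triangle x (f x) _).trans (add_le_add (hC x hx.1) (hD _ hx.2))
  · rw [PartialEquiv.trans_source]
    exact Filter.inter_mem hf (Ultrafilter.mem_map.mp hg)
  · rw [Ultrafilter.map_map, PartialEquiv.coe_trans]

variable (X) in
/-- Orbit equivalence on `βX`. -/
def orbSetoid : Setoid (Ultrafilter X) where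
  r ξ η := η ∈ Orb ξ
  iseqv := ⟨mem_Orb_self, mem_Orb_symm, mem_Orb_trans⟩

variable (X) in
/-- Quasi-orbit equivalence on `βX`: having the same orbit closure. -/
def qOrbSetoid : Setoid (Ultrafilter X) where
  r ξ η := closure (Orb ξ) = closure (Orb η)
  iseqv := ⟨fun _ => rfl, fun h => h.symm, fun h h' => h.trans h'⟩

variable (X) in
/-- The orbit space `𝒪rb(βX) = βX / Orb`, with the quotient topology. -/
abbrev OrbSpace : Type u := Quotient (orbSetoid X)

variable (X) in
/-- The quasi-orbit space `q-𝒪rb(βX) = βX / q-Orb`, with the quotient topology. -/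
abbrev QOrbSpace : Type u := Quotient (qOrbSetoid X)

/-- The class `Orb(ξ)` as a point of the orbit space. -/
def OrbSpace.mk (ξ : Ultrafilter X) : OrbSpace X := Quotient.mk (orbSetoid X) ξ

/-- The class `q-Orb(ξ)` as a point of the quasi-orbit space. -/
def QOrbSpace.mk (ξ : Ultrafilter X) : QOrbSpace X := Quotient.mk (qOrbSetoid X) ξ

/-! ### The uniform Roe algebra -/

/-- The Hilbert space `ℓ₂(X)`. -/
abbrev L2 (X : Type u) : Type u := lp (fun _ : X => ℂ) 2

open Classical in
/-- The canonical basis vector `δ_x` of `ℓ₂(X)`. -/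
def delta {X : Type u} (x : X) : L2 X := lp.single 2 x (1 : ℂ)

open Classical in
/-- The coordinates of `v_f g`. -/
def vFun {X : Type u} (f : PartialEquiv X X) (g : X → ℂ) (y : X) : ℂ :=
  if y ∈ f.target then g (f.symm y) else 0

theorem vFun_sum_le {X : Type u} (f : PartialEquiv X X) (g : L2 X) (s : Finset X) :
    ∑ y ∈ s, ‖vFun f g y‖ ^ (2 : ENNReal).toReal ≤ ‖g‖ ^ (2 : ENNReal).toReal := by
  classical
  have h2 : 0 < (2 : ENNReal).toReal := by norm_num
  have hinj : Set.InjOn f.symm ((s.filter (· ∈ f.target) : Finset X) : Set X) := by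
    intro a ha b hb hab
    rw [Finset.mem_coe, Finset.mem_filter] at ha hb
    exact f.symm.injOn ha.2 hb.2 hab
  calc ∑ y ∈ s, ‖vFun f g y‖ ^ (2 : ENNReal).toReal
      = ∑ y ∈ s.filter (· ∈ f.target), ‖g (f.symm y)‖ ^ (2 : ENNReal).toReal := by
        rw [Finset.sum_filter]
        refine Finset.sum_congr rfl fun y _ => ?_
        unfold vFun
        split_ifs <;> simp
    _ = ∑ x ∈ (s.filter (· ∈ f.target)).image f.symm, ‖g x‖ ^ (2 : ENNReal).toReal := by
        rw [Finset.sum_image hinj]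
    _ ≤ ‖g‖ ^ (2 : ENNReal).toReal := lp.sum_rpow_le_norm_rpow h2 g _

/-- The operator `v_f` on `ℓ₂(X)`, with `v_f δ_x = δ_{f x}` for `x ∈ f.source` and `v_f δ_x = 0`
otherwise. -/
def v {X : Type u} (f : PartialEquiv X X) : L2 X →L[ℂ] L2 X :=
  LinearMap.mkContinuous
    { toFun := fun g => ⟨vFun f g, memℓp_gen' (vFun_sum_le f g)⟩
      map_add' := fun g h => by
        ext y
        change vFun f _ y = vFun f _ y + vFun f _ y
        unfold vFun
        split_ifs <;> simp
      map_smul' := fun c g => by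
        ext y
        change vFun f _ y = c • vFun f _ y
        unfold vFun
        split_ifs <;> simp }
    1 fun g => by
      rw [one_mul]
      exact lp.norm_le_of_forall_sum_le (by norm_num) (norm_nonneg g) (vFun_sum_le f g)

theorem v_delta_of_mem {X : Type u} (f : PartialEquiv X X) {x : X} (hx : x ∈ f.source) :
    v f (delta x) = delta (f x) := by
  classical
  ext y
  change vFun f (delta x) y = _
  simp only [vFun, delta, lp.single_apply, Pi.single_apply]
  by_cases hy : y = f x
  · subst hy
    simp [f.map_source hx, f.left_inv hx]
  · rw [if_neg hy]
    split_ifs with h1 h2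
    · exact absurd (by rw [← h2, f.right_inv h1]) hy
    · rfl
    · rfl

theorem v_delta_of_notMem {X : Type u} (f : PartialEquiv X X) {x : X} (hx : x ∉ f.source) :
    v f (delta x) = 0 := by
  classical
  ext y
  change vFun f (delta x) y = 0
  simp only [vFun, delta, lp.single_apply, Pi.single_apply]
  split_ifs with h1 h2
  · exact absurd (h2 ▸ f.map_target h1) hx
  · rfl
  · rfl

variable (X) in
/-- The closed `*`-subalgebra of `B(ℓ₂(X))` generated by the `v_f`, `f` a partial translation. (It is
unital in any case, as the identity of `X` is a partial translation.) -/
def roeSubalgebra : StarSubalgebra ℂ (L2 X →L[ℂ] L2 X) :=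
  (StarAlgebra.adjoin ℂ {T | ∃ f : PartialEquiv X X, IsPartialTranslation f ∧ T = v f}).topologicalClosure

variable (X) in
/-- The uniform Roe algebra `C*_u(X)`. -/
def Roe : Type u := roeSubalgebra X

instance : CStarAlgebra (roeSubalgebra X) :=
  StarSubalgebra.cstarAlgebra (roeSubalgebra X)
    (h_closed := StarSubalgebra.isClosed_topologicalClosure _)

instance : CStarAlgebra (Roe X) := inferInstanceAs (CStarAlgebra (roeSubalgebra X))

/-- The usual order of a C*-algebra (positive elements are the `b* b`). -/
instance : PartialOrder (Roe X) := CStarAlgebra.spectralOrder (Roe X)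

instance : StarOrderedRing (Roe X) := CStarAlgebra.spectralOrderedRing (Roe X)

/-- The inclusion of the uniform Roe algebra into `B(ℓ₂(X))`. -/
def Roe.toOp : Roe X →⋆ₐ[ℂ] (L2 X →L[ℂ] L2 X) := (roeSubalgebra X).subtype

/-! ### The states `φ_ξ` and their GNS representations -/

/-- The diagonal `E(a)` of an operator `a` on `ℓ₂(X)`, as a function on `X`. -/
def diag {X : Type u} (a : L2 X →L[ℂ] L2 X) (x : X) : ℂ := inner ℂ (delta x) (a (delta x))

/-- The value at `ξ ∈ βX` of (the continuous extension to `βX` of) a bounded function on `X`. -/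
def evalAt {X : Type u} (ξ : Ultrafilter X) (h : X → ℂ) : ℂ :=
  limUnder (ξ : Filter X) h

theorem norm_delta {X : Type u} (x : X) : ‖delta x‖ = 1 := by
  classical
  unfold delta
  rw [lp.norm_single (by norm_num)]
  simp

theorem norm_diag_le {X : Type u} (a : L2 X →L[ℂ] L2 X) (x : X) : ‖diag a x‖ ≤ ‖a‖ := by
  refine (norm_inner_le_norm _ _).trans ?_
  have := a.le_opNorm (delta x)
  rw [norm_delta, mul_one] at this
  rwa [norm_delta, one_mul]

theorem tendsto_evalAt {X : Type u} (ξ : Ultrafilter X) {h : X → ℂ} {C : ℝ}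
    (hC : ∀ x, ‖h x‖ ≤ C) : Tendsto h (ξ : Filter X) (𝓝 (evalAt ξ h)) := by
  have hle : ((ξ.map h : Ultrafilter ℂ) : Filter ℂ) ≤ 𝓟 (Metric.closedBall 0 C) := by
    rw [Filter.le_principal_iff, Ultrafilter.mem_coe, Ultrafilter.mem_map]
    refine Filter.mem_of_superset Filter.univ_mem fun x _ => ?_
    rw [Set.mem_preimage, mem_closedBall_zero_iff]
    exact hC x
  obtain ⟨z, -, hz⟩ := (isCompact_closedBall (0 : ℂ) C).ultrafilter_le_nhds _ hle
  have h1 : ∃ z, Tendsto h (ξ : Filter X) (𝓝 z) := ⟨z, hz⟩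
  exact tendsto_nhds_limUnder h1

theorem tendsto_diag {X : Type u} (ξ : Ultrafilter X) (a : L2 X →L[ℂ] L2 X) :
    Tendsto (diag a) (ξ : Filter X) (𝓝 (evalAt ξ (diag a))) :=
  tendsto_evalAt ξ (norm_diag_le a)

/-- The state `φ_ξ(a) = E(a)(ξ)` on the uniform Roe algebra. -/
def state (ξ : Ultrafilter X) : Roe X →ₚ[ℂ] ℂ :=
  PositiveLinearMap.mk₀
    { toFun := fun a => evalAt ξ (diag (Roe.toOp a))
      map_add' := fun a b => by
        refine tendsto_nhds_unique (tendsto_diag ξ _) ?_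
        refine ((tendsto_diag ξ (Roe.toOp a)).add (tendsto_diag ξ (Roe.toOp b))).congr fun x => ?_
        simp [diag]
      map_smul' := fun c a => by
        refine tendsto_nhds_unique (tendsto_diag ξ _) ?_
        refine ((tendsto_diag ξ (Roe.toOp a)).const_smul c).congr fun x => ?_
        simp [diag] }
    (fun a ha => by
      obtain ⟨b, rfl⟩ := CStarAlgebra.nonneg_iff_eq_star_mul_self.mp ha
      refine ge_of_tendsto' (tendsto_diag ξ _) fun x => ?_
      have h1 : diag (Roe.toOp (star b * b)) x
          = inner ℂ (Roe.toOp b (delta x)) (Roe.toOp b (delta x)) := by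
        rw [diag, map_mul, map_star, ContinuousLinearMap.star_eq_adjoint,
          mul_apply_eq_comp, ContinuousLinearMap.adjoint_inner_right]
      rw [h1, inner_self_eq_norm_sq_to_K]
      exact pow_nonneg (RCLike.ofReal_nonneg.mpr (norm_nonneg _)) 2)

/-- The Hilbert space `H_ξ` of the GNS construction for `φ_ξ`. -/
abbrev GNSSpace (ξ : Ultrafilter X) : Type u := (state ξ).GNS

/-- The GNS representation `π_ξ` of the uniform Roe algebra, `π_ξ(a)(b + N_ξ) = ab + N_ξ`. -/
def gnsRep (ξ : Ultrafilter X) : Roe X →⋆ₐ[ℂ] (GNSSpace ξ →L[ℂ] GNSSpace ξ) :=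
  (state ξ).gnsStarAlgHom

/-! ### Irreducible representations and primitive ideals of a unital C*-algebra -/

/-- A (unital) representation on a nonzero Hilbert space is irreducible if it has no closed
invariant subspaces other than `0` and the whole space. -/
def IsIrreducible {A : Type u} [CStarAlgebra A] {H : Type u} [NormedAddCommGroup H]
    [InnerProductSpace ℂ H] [CompleteSpace H] (π : A →⋆ₐ[ℂ] (H →L[ℂ] H)) : Prop :=
  Nontrivial H ∧ ∀ K : Submodule ℂ H, IsClosed (K : Set H) →
    (∀ a : A, ∀ w ∈ K, π a w ∈ K) → K = ⊥ ∨ K = ⊤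

/-- Irreducible representations of `A`. An irreducible representation is cyclic, so that Hilbert
spaces in the universe of `A` suffice, up to unitary equivalence. -/
structure IrrRep (A : Type u) [CStarAlgebra A] : Type (u + 1) where
  H : Type u
  [normedAddCommGroup : NormedAddCommGroup H]
  [innerProductSpace : InnerProductSpace ℂ H]
  [completeSpace : CompleteSpace H]
  π : A →⋆ₐ[ℂ] (H →L[ℂ] H)
  irreducible : IsIrreducible π

attribute [instance] IrrRep.normedAddCommGroup IrrRep.innerProductSpace IrrRep.completeSpace

variable {A : Type u} [CStarAlgebra A]

/-- Unitary equivalence of irreducible representations. -/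
def UnitarilyEquivalent (ρ σ : IrrRep A) : Prop :=
  ∃ U : ρ.H ≃ₗᵢ[ℂ] σ.H, ∀ (a : A) (w : ρ.H), U (ρ.π a w) = σ.π a (U w)

variable (A) in
/-- Unitary equivalence as a setoid. -/
def irrSetoid : Setoid (IrrRep A) where
  r := UnitarilyEquivalent
  iseqv :=
    { refl := fun ρ => ⟨LinearIsometryEquiv.refl ℂ ρ.H, fun _ _ => rfl⟩
      symm := fun {ρ σ} ⟨U, hU⟩ => ⟨U.symm, fun a w => by
        apply U.injective
        rw [hU, U.apply_symm_apply, U.apply_symm_apply]⟩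
      trans := fun {ρ σ τ} ⟨U, hU⟩ ⟨V, hV⟩ => ⟨U.trans V, fun a w => by
        simp only [LinearIsometryEquiv.trans_apply, hU, hV]⟩ }

variable (A) in
/-- `Irr(A)`: irreducible representations modulo unitary equivalence. -/
def Irr : Type (u + 1) := Quotient (irrSetoid A)

/-- The class `[π]` of an irreducible representation `π`. -/
def Irr.mk {H : Type u} [NormedAddCommGroup H] [InnerProductSpace ℂ H] [CompleteSpace H]
    (π : A →⋆ₐ[ℂ] (H →L[ℂ] H)) (hπ : IsIrreducible π) : Irr A :=
  Quotient.mk (irrSetoid A) ⟨H, π, hπ⟩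

/-- An ideal is primitive if it is the kernel of an irreducible representation. -/
def IsPrimitive (I : Ideal A) : Prop := ∃ ρ : IrrRep A, RingHom.ker ρ.π = I

variable (A) in
/-- `Prim(A)`: the primitive ideals of `A`. -/
def Prim : Type u := {I : Ideal A // IsPrimitive I}

/-- The hull of a set `R` of primitive ideals: the primitive ideals that contain `⋂ R` (which is `A`
if `R` is empty). -/
def hull (R : Set (Prim A)) : Set (Prim A) := {J | sInf (Subtype.val '' R) ≤ J.1}

/-- The hull-kernel (Jacobson) topology. -/
instance : TopologicalSpace (Prim A) :=
  TopologicalSpace.generateFrom {W | ∃ R : Set (Prim A), W = (hull R)ᶜ}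

/-- The canonical map `[π] ↦ ker π` from `Irr(A)` to `Prim(A)`. -/
def Irr.ker : Irr A → Prim A :=
  Quotient.lift (fun ρ : IrrRep A => (⟨RingHom.ker ρ.π, ρ, rfl⟩ : Prim A)) (by
    rintro ρ σ ⟨U, hU⟩
    apply Subtype.ext
    ext a
    simp only [RingHom.mem_ker]
    constructor
    · intro h
      ext w
      obtain ⟨w, rfl⟩ := U.surjective w
      rw [← hU, h]
      simp
    · intro h
      ext w
      apply U.injective
      rw [hU, h]
      simp)

/-- The smallest topology on `Irr(A)` that makes `[π] ↦ ker π` continuous. -/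
instance : TopologicalSpace (Irr A) := TopologicalSpace.induced Irr.ker inferInstance

end

end UniformRoe

/-!
Write `Ω` for the cyclic vector of `π_ξ` and `χ_B` for the projection onto `ℓ₂(B)`.

The `v_f` are closed under products and adjoints, so their span is dense in the uniform Roe algebra
(`dense_shiftSpan`) and the vectors `π_ξ(v_f)Ω` are total in the space `H_ξ` of `π_ξ`. Moreover
`‖π_ξ(a)Ω‖` is the limit of `‖a δ_x‖` along `ξ` (`tendsto_norm_toOp_delta`), so identities between
vectors `π_ξ(a)Ω` may be checked on the `δ_x`, for `x` in a set of `ξ`. In particular `π_ξ(v_f)Ω` is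
`0` if the domain of `f` is not in `ξ`; otherwise it lives over the point `η = f ξ` of the orbit, i.e.
it is fixed by `χ_B` for all `B ∈ η`.

Irreducibility and the map on orbits rest on the converse (`mem_closure_fiber`): a vector of `H_ξ`
fixed by `χ_B` for all `B ∈ η` is a limit of combinations of vectors `π_ξ(v_f)Ω` with `f ξ = η`. For
`η` outside the orbit there are no such vectors. For `η = ξ` they are all equal to `Ω`, because a
partial injection that fixes `ξ` is the identity on a set in `ξ` (`eventually_eq_self_of_map_eq`).
Thus the projection of `Ω` to a closed invariant subspace is a multiple of `Ω`, and `π_ξ` is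
irreducible. A unitary equivalence of `π_η` with `π_ξ` carries the cyclic vector of `π_η` to a nonzero
vector over `η`, so that `η` is in the orbit of `ξ`; conversely, if `η = f ξ` then `φ_η` is the vector
state of `π_ξ(v_f)Ω`.

For the topologies, `a ∈ ker π_ξ` if and only if `π_η(a)` kills the cyclic vector of `π_η` for all `η`
in the orbit of `ξ` (`mem_ker_gnsRep_iff`). Since `ξ ↦ ‖π_ξ(a)Ω‖` is continuous, so is `ξ ↦ ker π_ξ`.
A closed union `C` of orbits is the preimage of the hull of the kernels of its points
(`mem_iff_of_isClosed_of_invariant`), as the `χ_B` separate `C` from the other points. So both orbit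
spaces carry the topology induced from the primitive ideal space (`isInducing_of_primAt`), and
`ker π_ξ = ker π_η` exactly if the orbit closures agree.
-/

namespace UniformRoe

section

/-! ### Partial injections and partial translations -/

/-- A partial injection that fixes an ultrafilter fixes almost every point. If `M` is maximal among
the sets of non-fixed points disjoint from their image, then the non-fixed points are covered by `M`,
its preimage and its image, none of which can belong to the ultrafilter. -/
theorem eventually_eq_self_of_map_eq {X : Type u} {ξ : Ultrafilter X} {f : PartialEquiv X X}
    (hf : f.source ∈ ξ) (hξ : ξ.map f = ξ) : ∀ᶠ x in (ξ : Filter X), f x = x := by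
  have hmap : ∀ B : Set X, f ⁻¹' B ∈ ξ ↔ B ∈ ξ := fun B => by
    rw [← Ultrafilter.mem_map, hξ]
  let S : Set (Set X) := {M | M ⊆ f.source ∧ ∀ x ∈ M, ∀ y ∈ M, f x ≠ y}
  obtain ⟨M, ⟨hMs, hMd⟩, hMmax⟩ : ∃ M, Maximal (· ∈ S) M := by
    refine zorn_subset S fun c hcS hc => ⟨⋃₀ c, ⟨?_, ?_⟩, fun s hs => Set.subset_sUnion_of_mem hs⟩
    · exact Set.sUnion_subset fun s hs => (hcS hs).1
    · rintro x ⟨s, hs, hxs⟩ y ⟨t, ht, hyt⟩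
      rcases hc.total hs ht with h | h
      · exact (hcS ht).2 x (h hxs) y hyt
      · exact (hcS hs).2 x hxs y (h hyt)
  have hcover : f.source ⊆ {x | f x = x} ∪ (M ∪ (f ⁻¹' M ∪ f '' M)) := by
    intro x hx
    by_contra! hcon
    simp only [Set.mem_union, Set.mem_ofPred_eq, Set.mem_preimage, Set.mem_image, not_or,
      not_exists, not_and] at hcon
    obtain ⟨h1, h2, h3, h4⟩ := hcon
    refine h2 (hMmax (y := insert x M) ⟨Set.insert_subset hx hMs, ?_⟩ (Set.subset_insert x M)
      (Set.mem_insert x M))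
    rintro a (rfl | ha) b (rfl | hb)
    · exact h1
    · exact fun h => h3 (h ▸ hb)
    · exact h4 a ha
    · exact hMd a ha b hb
  have hM : M ∉ ξ := fun hM => by
    obtain ⟨x, hx, hx'⟩ := ξ.nonempty_of_mem (Filter.inter_mem hM ((hmap M).mpr hM))
    exact hMd x hx _ hx' rfl
  have hM' : f '' M ∉ ξ := fun h => hM <| by
    refine Filter.mem_of_superset (Filter.inter_mem hf ((hmap _).mpr h)) ?_
    rintro x ⟨hx, y, hy, hxy⟩
    rwa [← f.injOn (hMs hy) hx hxy]
  have h := Filter.mem_of_superset hf hcover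
  rw [Ultrafilter.mem_coe, Ultrafilter.union_mem_iff, Ultrafilter.union_mem_iff,
    Ultrafilter.union_mem_iff, hmap] at h
  tauto

theorem isPartialTranslation_ofSet {X : Type u} [MetricSpace X] (B : Set X) :
    IsPartialTranslation (PartialEquiv.ofSet B) :=
  ⟨0, fun x _ => by simp⟩

theorem IsPartialTranslation.symm {X : Type u} [MetricSpace X] {f : PartialEquiv X X}
    (hf : IsPartialTranslation f) : IsPartialTranslation f.symm := by
  obtain ⟨C, hC⟩ := hf
  refine ⟨C, fun x hx => ?_⟩
  have h := hC _ (f.map_target hx)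
  rwa [f.right_inv hx, dist_comm] at h

theorem IsPartialTranslation.trans {X : Type u} [MetricSpace X] {f g : PartialEquiv X X}
    (hf : IsPartialTranslation f) (hg : IsPartialTranslation g) :
    IsPartialTranslation (f.trans g) := by
  obtain ⟨C, hC⟩ := hf
  obtain ⟨D, hD⟩ := hg
  refine ⟨C + D, fun x hx => ?_⟩
  rw [PartialEquiv.trans_source] at hx
  exact (dist_triangle x (f x) _).trans (add_le_add (hC x hx.1) (hD _ hx.2))

/-! ### The operators `v_f` and their span -/

theorem inner_delta {X : Type u} (x : X) (w : L2 X) : inner ℂ (delta x) w = w x := by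
  classical
  unfold delta
  rw [lp.inner_single_left]
  simp

theorem vFun_of_mem {X : Type u} {f : PartialEquiv X X} (g : X → ℂ) {y : X} (hy : y ∈ f.target) :
    vFun f g y = g (f.symm y) := if_pos hy

theorem vFun_of_notMem {X : Type u} {f : PartialEquiv X X} (g : X → ℂ) {y : X}
    (hy : y ∉ f.target) : vFun f g y = 0 := if_neg hy

theorem v_mul_v {X : Type u} (f g : PartialEquiv X X) : v f * v g = v (g.trans f) := by
  ext w y
  change vFun f (vFun g w) y = vFun (g.trans f) w y
  by_cases h1 : y ∈ f.target
  · by_cases h2 : f.symm y ∈ g.target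
    · rw [vFun_of_mem _ h1, vFun_of_mem _ h2, vFun_of_mem _ (f := g.trans f)]
      · rfl
      · rw [PartialEquiv.trans_target]
        exact ⟨h1, h2⟩
    · rw [vFun_of_mem _ h1, vFun_of_notMem _ h2, vFun_of_notMem _ (f := g.trans f)]
      rw [PartialEquiv.trans_target]
      exact fun h => h2 h.2
  · rw [vFun_of_notMem _ h1, vFun_of_notMem _ (f := g.trans f)]
    rw [PartialEquiv.trans_target]
    exact fun h => h1 h.1

theorem star_v {X : Type u} (f : PartialEquiv X X) : star (v f) = v f.symm := by
  ext w y
  rw [← inner_delta, ContinuousLinearMap.star_eq_adjoint, ContinuousLinearMap.adjoint_inner_right]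
  change _ = vFun f.symm w y
  by_cases hy : y ∈ f.source
  · rw [v_delta_of_mem f hy, inner_delta]
    simp [vFun, hy]
  · rw [v_delta_of_notMem f hy, inner_zero_left]
    simp [vFun, hy]

theorem v_refl {X : Type u} : v (PartialEquiv.refl X) = 1 := by
  ext w y
  change vFun _ w y = w y
  simp [vFun]

theorem norm_v_le {X : Type u} (f : PartialEquiv X X) : ‖v f‖ ≤ 1 :=
  LinearMap.mkContinuous_norm_le _ zero_le_one _

variable {X : Type u} [MetricSpace X]

/-- The operators `v_f` are closed under products and adjoints, so that the `*`-algebra they generate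
is just their linear span. -/
theorem adjoin_le_span :
    Subalgebra.toSubmodule (StarAlgebra.adjoin ℂ
      {T | ∃ f : PartialEquiv X X, IsPartialTranslation f ∧ T = v f}).toSubalgebra ≤
    Submodule.span ℂ {T | ∃ f : PartialEquiv X X, IsPartialTranslation f ∧ T = v f} := by
  rw [StarAlgebra.adjoin_eq_span]
  refine Submodule.span_mono ?_
  let M : Submonoid (L2 X →L[ℂ] L2 X) :=
    { carrier := {T | ∃ f : PartialEquiv X X, IsPartialTranslation f ∧ T = v f}
      one_mem' := ⟨PartialEquiv.refl X, ⟨0, fun x _ => by simp⟩, v_refl.symm⟩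
      mul_mem' := by
        rintro _ _ ⟨f, hf, rfl⟩ ⟨g, hg, rfl⟩
        exact ⟨g.trans f, hg.trans hf, v_mul_v f g⟩ }
  refine (Submonoid.closure_le (S := M)).mpr (Set.union_subset (fun T hT => hT) ?_)
  rintro T ⟨f, hf, hT⟩
  exact ⟨f.symm, hf.symm, by rw [← star_v, ← hT, star_star]⟩

/-- The partial isometry `v_f` as an element of the uniform Roe algebra. -/
noncomputable def shift (f : PartialEquiv X X) (hf : IsPartialTranslation f) : Roe X :=
  (⟨v f, StarSubalgebra.le_topologicalClosure _ (StarAlgebra.subset_adjoin ℂ _ ⟨f, hf, rfl⟩)⟩ :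
    roeSubalgebra X)

theorem norm_toOp (a : Roe X) : ‖Roe.toOp a‖ = ‖a‖ := rfl

theorem toOp_shift_delta_of_mem (f : PartialEquiv X X) (hf : IsPartialTranslation f) {x : X}
    (hx : x ∈ f.source) : Roe.toOp (shift f hf) (delta x) = delta (f x) :=
  v_delta_of_mem f hx

theorem toOp_shift_delta_of_notMem (f : PartialEquiv X X) (hf : IsPartialTranslation f) {x : X}
    (hx : x ∉ f.source) : Roe.toOp (shift f hf) (delta x) = 0 :=
  v_delta_of_notMem f hx

variable (X) in
/-- The linear span of the partial isometries `v_f` in the uniform Roe algebra. -/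
noncomputable def shiftSpan : Submodule ℂ (Roe X) :=
  Submodule.span ℂ {a | ∃ f hf, a = shift f hf}

theorem dense_shiftSpan : Dense (shiftSpan X : Set (Roe X)) := by
  intro a
  have ha : Roe.toOp a ∈ closure (StarAlgebra.adjoin ℂ
      {T | ∃ f : PartialEquiv X X, IsPartialTranslation f ∧ T = v f} :
        Set (L2 X →L[ℂ] L2 X)) := (show roeSubalgebra X from a).2
  rw [Metric.mem_closure_iff] at ha ⊢
  intro ε hε
  obtain ⟨b, hb, hab⟩ := ha ε hε
  have hmap : (shiftSpan X).map (Roe.toOp (X := X)).toAlgHom.toLinearMap =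
      Submodule.span ℂ {T | ∃ f : PartialEquiv X X, IsPartialTranslation f ∧ T = v f} := by
    rw [shiftSpan, Submodule.map_span]
    congr 1
    ext T
    constructor
    · rintro ⟨_, ⟨f, hf, rfl⟩, rfl⟩
      exact ⟨f, hf, rfl⟩
    · rintro ⟨f, hf, rfl⟩
      exact ⟨_, ⟨f, hf, rfl⟩, rfl⟩
  obtain ⟨c, hc, rfl⟩ := hmap.ge (adjoin_le_span hb)
  refine ⟨c, hc, ?_⟩
  rw [dist_eq_norm] at hab ⊢
  rw [← norm_toOp, map_sub]
  exact hab

/-- The projection of `ℓ₂(X)` onto `ℓ₂(B)`, as an element of the uniform Roe algebra. -/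
noncomputable def proj (B : Set X) : Roe X :=
  shift (PartialEquiv.ofSet B) (isPartialTranslation_ofSet B)

theorem toOp_proj_delta_of_mem {B : Set X} {x : X} (hx : x ∈ B) :
    Roe.toOp (proj B) (delta x) = delta x :=
  toOp_shift_delta_of_mem _ _ hx

theorem toOp_proj_delta_of_notMem {B : Set X} {x : X} (hx : x ∉ B) :
    Roe.toOp (proj B) (delta x) = 0 :=
  toOp_shift_delta_of_notMem _ _ hx

theorem proj_inter (A B : Set X) : proj (A ∩ B) = proj A * proj B := by
  apply Subtype.val_injective (p := fun T => T ∈ roeSubalgebra X)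
  change v _ = v _ * v _
  rw [v_mul_v]
  refine congrArg v (PartialEquiv.ext (fun _ => rfl) (fun _ => rfl) ?_)
  simp [PartialEquiv.trans_source, Set.inter_comm]

theorem norm_proj_le (B : Set X) : ‖proj B‖ ≤ 1 := by
  rw [← norm_toOp]
  exact norm_v_le _

/-! ### The cyclic vectors -/

/-- The canonical cyclic vector of `π_ξ`, the class of the unit of the uniform Roe algebra. -/
noncomputable def cyc (ξ : Ultrafilter X) : GNSSpace ξ := ((state ξ).toPreGNS 1 : (state ξ).PreGNS)

theorem gnsRep_cyc (ξ : Ultrafilter X) (a : Roe X) :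
    gnsRep ξ a (cyc ξ) = ((state ξ).toPreGNS a : (state ξ).PreGNS) := by
  change (state ξ).gnsNonUnitalStarAlgHom a _ = _
  rw [cyc, PositiveLinearMap.gnsNonUnitalStarAlgHom_apply_coe]
  simp

theorem denseRange_gnsRep_cyc (ξ : Ultrafilter X) : DenseRange fun a => gnsRep ξ a (cyc ξ) := by
  simp only [gnsRep_cyc]
  exact UniformSpace.Completion.denseRange_coe.comp
    (state ξ).toPreGNS.surjective.denseRange (UniformSpace.Completion.continuous_coe _)

/-- The defining property of `π_ξ`: the vector `π_ξ(a)Ω` records the vectors `a δ_x` along `ξ`. -/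
theorem tendsto_norm_toOp_delta (ξ : Ultrafilter X) (a : Roe X) :
    Tendsto (fun x => ‖Roe.toOp a (delta x)‖) (ξ : Filter X) (𝓝 ‖gnsRep ξ a (cyc ξ)‖) := by
  have h := tendsto_diag ξ (Roe.toOp (star a * a))
  have h1 : ∀ x, ‖Roe.toOp a (delta x)‖ = √(diag (Roe.toOp (star a * a)) x).re := fun x => by
    rw [diag, map_mul, map_star, ContinuousLinearMap.star_eq_adjoint, mul_apply_eq_comp,
      ContinuousLinearMap.adjoint_inner_right, inner_self_eq_norm_sq_to_K]
    norm_cast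
    exact (Real.sqrt_sq (norm_nonneg _)).symm
  rw [gnsRep_cyc, UniformSpace.Completion.norm_coe, PositiveLinearMap.preGNS_norm_def]
  simp only [h1]
  exact (Real.continuous_sqrt.tendsto _).comp ((Complex.continuous_re.tendsto _).comp h)

theorem gnsRep_cyc_congr {ξ : Ultrafilter X} {a b : Roe X}
    (h : ∀ᶠ x in (ξ : Filter X), Roe.toOp a (delta x) = Roe.toOp b (delta x)) :
    gnsRep ξ a (cyc ξ) = gnsRep ξ b (cyc ξ) := by
  rw [← sub_eq_zero, ← sub_apply, ← map_sub, ← norm_eq_zero]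
  refine tendsto_nhds_unique (tendsto_norm_toOp_delta ξ _) (tendsto_const_nhds.congr' ?_)
  filter_upwards [h] with x hx
  rw [map_sub, sub_apply, hx, sub_self, norm_zero]

theorem gnsRep_cyc_eq_zero {ξ : Ultrafilter X} {a : Roe X}
    (h : ∀ᶠ x in (ξ : Filter X), Roe.toOp a (delta x) = 0) : gnsRep ξ a (cyc ξ) = 0 := by
  have h0 : gnsRep ξ a (cyc ξ) = gnsRep ξ 0 (cyc ξ) := by
    refine gnsRep_cyc_congr ?_
    filter_upwards [h] with x hx
    rw [hx, map_zero, zero_apply]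
  rw [h0, map_zero, zero_apply]

theorem norm_cyc (ξ : Ultrafilter X) : ‖cyc ξ‖ = 1 := by
  have h := tendsto_norm_toOp_delta ξ 1
  simp only [map_one, one_apply_eq_self, norm_delta] at h
  exact tendsto_nhds_unique h tendsto_const_nhds

theorem cyc_ne_zero (ξ : Ultrafilter X) : cyc ξ ≠ 0 := by
  rw [← norm_ne_zero_iff, norm_cyc]
  exact one_ne_zero

theorem gnsRep_proj_cyc {ξ : Ultrafilter X} {B : Set X} (hB : B ∈ ξ) :
    gnsRep ξ (proj B) (cyc ξ) = cyc ξ := by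
  have h1 : gnsRep ξ (proj B) (cyc ξ) = gnsRep ξ 1 (cyc ξ) := by
    refine gnsRep_cyc_congr ?_
    filter_upwards [hB] with x hx
    rw [toOp_proj_delta_of_mem hx, map_one, one_apply_eq_self]
  rw [h1, map_one, one_apply_eq_self]

theorem norm_gnsRep_proj_le (ξ : Ultrafilter X) (B : Set X) (w : GNSSpace ξ) :
    ‖gnsRep ξ (proj B) w‖ ≤ ‖w‖ := by
  refine ((gnsRep ξ (proj B)).le_opNorm w).trans (mul_le_of_le_one_left (norm_nonneg _) ?_)
  exact (NonUnitalStarAlgHom.norm_apply_le (gnsRep ξ) _).trans (norm_proj_le B)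

theorem gnsRep_shift_cyc_of_notMem {ξ : Ultrafilter X} {f : PartialEquiv X X}
    (hf : IsPartialTranslation f) (h : f.source ∉ ξ) : gnsRep ξ (shift f hf) (cyc ξ) = 0 := by
  refine gnsRep_cyc_eq_zero ?_
  filter_upwards [Ultrafilter.compl_mem_iff_notMem.mpr h] with x hx
  exact toOp_shift_delta_of_notMem f hf hx

theorem gnsRep_proj_shift_cyc_of_mem {ξ : Ultrafilter X} {f : PartialEquiv X X}
    (hf : IsPartialTranslation f) (h : f.source ∈ ξ) {B : Set X} (hB : B ∈ ξ.map f) :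
    gnsRep ξ (proj B) (gnsRep ξ (shift f hf) (cyc ξ)) = gnsRep ξ (shift f hf) (cyc ξ) := by
  rw [← mul_apply_eq_comp, ← map_mul]
  refine gnsRep_cyc_congr ?_
  filter_upwards [h, Ultrafilter.mem_map.mp hB] with x hx hx'
  rw [map_mul, mul_apply_eq_comp, toOp_shift_delta_of_mem f hf hx,
    toOp_proj_delta_of_mem (Set.mem_preimage.mp hx')]

theorem gnsRep_proj_shift_cyc_of_notMem {ξ : Ultrafilter X} {f : PartialEquiv X X}
    (hf : IsPartialTranslation f) {B : Set X} (hB : B ∉ ξ.map f) :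
    gnsRep ξ (proj B) (gnsRep ξ (shift f hf) (cyc ξ)) = 0 := by
  rw [← mul_apply_eq_comp, ← map_mul]
  refine gnsRep_cyc_eq_zero ?_
  filter_upwards [Ultrafilter.mem_map.mp (Ultrafilter.compl_mem_iff_notMem.mpr hB)] with x hx'
  rw [map_mul, mul_apply_eq_comp]
  by_cases hx : x ∈ f.source
  · rw [toOp_shift_delta_of_mem f hf hx, toOp_proj_delta_of_notMem (Set.mem_preimage.not.mp hx')]
  · rw [toOp_shift_delta_of_notMem f hf hx, map_zero]

/-! ### Localisation of vectors at points of an orbit -/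

/-- The vectors of the form `π_ξ(v_f)Ω`. -/
def shiftVectors (ξ : Ultrafilter X) : Set (GNSSpace ξ) :=
  {w | ∃ f hf, w = gnsRep ξ (shift f hf) (cyc ξ)}

theorem dense_span_shiftVectors (ξ : Ultrafilter X) :
    Dense (Submodule.span ℂ (shiftVectors ξ) : Set (GNSSpace ξ)) := by
  have hcont : Continuous fun a => gnsRep ξ a (cyc ξ) := by
    have h : Continuous fun a => gnsRep ξ a :=
      AddMonoidHomClass.continuous_of_bound (gnsRep ξ) 1 fun a => by
        rw [one_mul]
        exact NonUnitalStarAlgHom.norm_apply_le (gnsRep ξ) a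
    exact h.clm_apply continuous_const
  refine ((denseRange_gnsRep_cyc ξ).dense_image hcont dense_shiftSpan).mono ?_
  rintro _ ⟨a, ha, rfl⟩
  refine Submodule.span_induction (p := fun a _ =>
    gnsRep ξ a (cyc ξ) ∈ Submodule.span ℂ (shiftVectors ξ)) ?_ ?_ ?_ ?_ ha
  · rintro _ ⟨f, hf, rfl⟩
    exact Submodule.subset_span ⟨f, hf, rfl⟩
  · rw [map_zero]
    exact Submodule.zero_mem _
  · intro a b _ _ ha hb
    rw [map_add]
    exact Submodule.add_mem _ ha hb
  · intro c a _ ha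
    rw [map_smul]
    exact Submodule.smul_mem _ c ha

/-- The span of the vectors `π_ξ(v_f)Ω` with `f` mapping `ξ` to `η`: the vectors of `H_ξ` that live
over the point `η`. -/
noncomputable def fiber (ξ η : Ultrafilter X) : Submodule ℂ (GNSSpace ξ) :=
  Submodule.span ℂ
    {w | ∃ (f : PartialEquiv X X) (hf : IsPartialTranslation f),
      f.source ∈ ξ ∧ ξ.map f = η ∧ w = gnsRep ξ (shift f hf) (cyc ξ)}

theorem gnsRep_proj_of_mem_fiber {ξ η : Ultrafilter X} {B : Set X} (hB : B ∈ η) {w : GNSSpace ξ}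
    (hw : w ∈ fiber ξ η) : gnsRep ξ (proj B) w = w := by
  refine Submodule.span_induction (p := fun w _ => gnsRep ξ (proj B) w = w) ?_ ?_ ?_ ?_ hw
  · rintro _ ⟨f, hf, hs, rfl, rfl⟩
    exact gnsRep_proj_shift_cyc_of_mem hf hs hB
  · exact map_zero _
  · intro u w _ _ hu hw
    rw [map_add, hu, hw]
  · intro c w _ hw
    rw [map_smul, hw]

/-- A vector in the span involves finitely many points `f ξ`; a single set `B ∈ η` avoids those other
than `η`, and `χ_B` then removes the corresponding terms. -/
theorem exists_gnsRep_proj_mem_fiber {ξ : Ultrafilter X} (η : Ultrafilter X) {w : GNSSpace ξ}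
    (hw : w ∈ Submodule.span ℂ (shiftVectors ξ)) :
    ∃ B ∈ η, gnsRep ξ (proj B) w ∈ fiber ξ η := by
  refine Submodule.span_induction (p := fun w _ => ∃ B ∈ η, gnsRep ξ (proj B) w ∈ fiber ξ η)
    ?_ ?_ ?_ ?_ hw
  · rintro _ ⟨f, hf, rfl⟩
    by_cases hs : f.source ∈ ξ
    · by_cases hη : ξ.map f = η
      · refine ⟨Set.univ, Filter.univ_mem, ?_⟩
        rw [gnsRep_proj_shift_cyc_of_mem hf hs Filter.univ_mem]
        exact Submodule.subset_span ⟨f, hf, hs, hη, rfl⟩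
      · obtain ⟨B, hB, hB'⟩ : ∃ B ∈ η, B ∉ ξ.map f := by
          by_contra! h
          exact hη (Ultrafilter.coe_le_coe.mp h)
        refine ⟨B, hB, ?_⟩
        rw [gnsRep_proj_shift_cyc_of_notMem hf hB']
        exact Submodule.zero_mem _
    · refine ⟨Set.univ, Filter.univ_mem, ?_⟩
      rw [gnsRep_shift_cyc_of_notMem hf hs, map_zero]
      exact Submodule.zero_mem _
  · exact ⟨Set.univ, Filter.univ_mem, by rw [map_zero]; exact Submodule.zero_mem _⟩
  · rintro u w _ _ ⟨B, hB, hu⟩ ⟨C, hC, hw⟩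
    refine ⟨C ∩ B, Filter.inter_mem hC hB, ?_⟩
    have h1 : gnsRep ξ (proj (C ∩ B)) u = gnsRep ξ (proj B) u := by
      rw [proj_inter, map_mul, mul_apply_eq_comp, gnsRep_proj_of_mem_fiber hC hu]
    have h2 : gnsRep ξ (proj (C ∩ B)) w = gnsRep ξ (proj C) w := by
      rw [Set.inter_comm, proj_inter, map_mul, mul_apply_eq_comp, gnsRep_proj_of_mem_fiber hB hw]
    rw [map_add, h1, h2]
    exact Submodule.add_mem _ hu hw
  · rintro c w _ ⟨B, hB, hw⟩
    exact ⟨B, hB, by rw [map_smul]; exact Submodule.smul_mem _ c hw⟩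

/-- A vector fixed by the projections `χ_B`, `B ∈ η`, is a limit of vectors over `η`: cut down an
approximation of it by a suitable `χ_B`. -/
theorem mem_closure_fiber {ξ η : Ultrafilter X} {w : GNSSpace ξ}
    (hw : ∀ B ∈ η, gnsRep ξ (proj B) w = w) : w ∈ closure (fiber ξ η : Set (GNSSpace ξ)) := by
  rw [Metric.mem_closure_iff]
  intro ε hε
  obtain ⟨u, hu, hwu⟩ := Metric.mem_closure_iff.mp (dense_span_shiftVectors ξ w) ε hε
  obtain ⟨B, hB, hBu⟩ := exists_gnsRep_proj_mem_fiber η hu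
  refine ⟨_, hBu, ?_⟩
  conv_lhs => rw [← hw B hB]
  rw [dist_eq_norm] at hwu ⊢
  rw [← map_sub]
  exact (norm_gnsRep_proj_le ξ B _).trans_lt hwu

/-- The only vectors of `H_ξ` over `ξ` are the multiples of `Ω`, since a partial translation that
fixes `ξ` is the identity on a set in `ξ`. -/
theorem fiber_self_le (ξ : Ultrafilter X) : fiber ξ ξ ≤ Submodule.span ℂ {cyc ξ} := by
  refine Submodule.span_le.mpr ?_
  rintro _ ⟨f, hf, hs, hξ, rfl⟩
  have h1 : gnsRep ξ (shift f hf) (cyc ξ) = gnsRep ξ 1 (cyc ξ) := by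
    refine gnsRep_cyc_congr ?_
    filter_upwards [hs, eventually_eq_self_of_map_eq hs hξ] with x hx hx'
    rw [toOp_shift_delta_of_mem f hf hx, hx', map_one, one_apply_eq_self]
  rw [h1, map_one, one_apply_eq_self]
  exact Submodule.mem_span_singleton_self _

theorem fiber_eq_bot {ξ η : Ultrafilter X} (h : η ∉ Orb ξ) : fiber ξ η = ⊥ := by
  refine Submodule.span_eq_bot.mpr ?_
  rintro _ ⟨f, hf, hs, hη, rfl⟩
  exact absurd ⟨f, hf, hs, hη.symm⟩ h

/-! ### Irreducibility and unitary equivalence -/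

theorem eq_top_of_cyc_mem {ξ : Ultrafilter X} {K : Submodule ℂ (GNSSpace ξ)}
    (hK : IsClosed (K : Set (GNSSpace ξ))) (hinv : ∀ a, ∀ w ∈ K, gnsRep ξ a w ∈ K)
    (hcyc : cyc ξ ∈ K) : K = ⊤ := by
  refine (Submodule.eq_top_iff').mpr fun w => ?_
  refine hK.closure_subset_iff.mpr ?_ (denseRange_gnsRep_cyc ξ w)
  rintro _ ⟨a, rfl⟩
  exact hinv a _ hcyc

theorem isIrreducible_gnsRep (ξ : Ultrafilter X) : IsIrreducible (gnsRep ξ) := by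
  refine ⟨⟨cyc ξ, 0, cyc_ne_zero ξ⟩, fun K hK hinv => ?_⟩
  have : CompleteSpace K := hK.completeSpace_coe
  have hinv' : ∀ a, ∀ w ∈ Kᗮ, gnsRep ξ a w ∈ Kᗮ := by
    intro a w hw
    rw [Submodule.mem_orthogonal] at hw ⊢
    intro u hu
    have h := hw _ (hinv (star a) u hu)
    rwa [map_star, ContinuousLinearMap.star_eq_adjoint,
      ContinuousLinearMap.adjoint_inner_left] at h
  obtain ⟨p, hp, q, hq, hpq⟩ := K.exists_add_mem_mem_orthogonal (cyc ξ)
  -- The projection `p` of `Ω` to `K` is fixed by the same `χ_B` as `Ω`, so it is a multiple of `Ω`.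
  have hfix : ∀ B ∈ ξ, gnsRep ξ (proj B) p = p := by
    intro B hB
    have h1 : gnsRep ξ (proj B) p + gnsRep ξ (proj B) q = p + q := by
      rw [← map_add, ← hpq, gnsRep_proj_cyc hB]
    have h2 : gnsRep ξ (proj B) p - p = q - gnsRep ξ (proj B) q := by
      rw [sub_eq_sub_iff_add_eq_add, h1, add_comm]
    have h3 : gnsRep ξ (proj B) p - p ∈ K ⊓ Kᗮ :=
      ⟨K.sub_mem (hinv _ _ hp) hp, h2 ▸ Kᗮ.sub_mem hq (hinv' _ _ hq)⟩
    rw [K.inf_orthogonal_eq_bot, Submodule.mem_bot] at h3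
    exact sub_eq_zero.mp h3
  have hmem : p ∈ Submodule.span ℂ {cyc ξ} :=
    (Submodule.closed_of_finiteDimensional (Submodule.span ℂ {cyc ξ})).closure_subset_iff.mpr
      (fiber_self_le ξ) (mem_closure_fiber hfix)
  obtain ⟨c, rfl⟩ := Submodule.mem_span_singleton.mp hmem
  by_cases hc : c = 0
  · left
    rw [← Submodule.orthogonal_eq_top_iff]
    refine eq_top_of_cyc_mem (Submodule.isClosed_orthogonal K) hinv' ?_
    rwa [hpq, hc, zero_smul, zero_add]
  · right
    exact eq_top_of_cyc_mem hK hinv ((K.smul_mem_iff hc).mp hp)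

theorem unitarilyEquivalent_of_norm_eq {A : Type u} [CStarAlgebra A] (ρ σ : IrrRep A) (h : ρ.H)
    (k : σ.H) (hh : DenseRange fun a => ρ.π a h) (hk : DenseRange fun a => σ.π a k)
    (hnorm : ∀ a, ‖σ.π a k‖ = ‖ρ.π a h‖) : UnitarilyEquivalent ρ σ := by
  let e₁ : A →ₗ[ℂ] ρ.H :=
    { toFun := fun a => ρ.π a h
      map_add' := fun a b => by rw [map_add, add_apply]
      map_smul' := fun c a => by rw [map_smul, smul_apply]; rfl }
  let e₂ : A →ₗ[ℂ] σ.H :=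
    { toFun := fun a => σ.π a k
      map_add' := fun a b => by rw [map_add, add_apply]
      map_smul' := fun c a => by rw [map_smul, smul_apply]; rfl }
  let U : ρ.H ≃ₗᵢ[ℂ] σ.H :=
    (LinearEquiv.refl ℂ A).extendOfIsometry e₁ e₂ hh hk hnorm
  have hU : ∀ a, U (ρ.π a h) = σ.π a k := fun a =>
    LinearEquiv.extendOfIsometry_eq (LinearEquiv.refl ℂ A) e₁ e₂ hh hk hnorm a
  refine ⟨U, fun a w => ?_⟩
  refine hh.induction_on (p := fun w => U (ρ.π a w) = σ.π a (U w)) w ?_ fun b => ?_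
  · exact isClosed_eq (U.continuous.comp (ρ.π a).continuous) ((σ.π a).continuous.comp U.continuous)
  · rw [← mul_apply_eq_comp, ← map_mul, hU, hU, map_mul, mul_apply_eq_comp]

theorem norm_gnsRep_map_cyc {ξ : Ultrafilter X} {f : PartialEquiv X X}
    (hf : IsPartialTranslation f) (hs : f.source ∈ ξ) (a : Roe X) :
    ‖gnsRep (ξ.map f) a (cyc (ξ.map f))‖ = ‖gnsRep ξ a (gnsRep ξ (shift f hf) (cyc ξ))‖ := by
  rw [← mul_apply_eq_comp, ← map_mul]
  have h1 := tendsto_norm_toOp_delta (ξ.map f) a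
  rw [Ultrafilter.coe_map, tendsto_map'_iff] at h1
  refine tendsto_nhds_unique_of_eventuallyEq h1 (tendsto_norm_toOp_delta ξ _) ?_
  filter_upwards [hs] with x hx
  rw [map_mul, mul_apply_eq_comp, toOp_shift_delta_of_mem f hf hx]
  rfl

/-- Representations at points of the same orbit are equivalent: if `f` maps `ξ` to `η`, then `φ_η` is
the vector state of `π_ξ(v_f)Ω`. -/
theorem unitarilyEquivalent_of_mem_Orb {ξ η : Ultrafilter X} (h : η ∈ Orb ξ) :
    UnitarilyEquivalent (⟨GNSSpace η, gnsRep η, isIrreducible_gnsRep η⟩ : IrrRep (Roe X))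
      ⟨GNSSpace ξ, gnsRep ξ, isIrreducible_gnsRep ξ⟩ := by
  obtain ⟨f, hf, hs, rfl⟩ := h
  refine unitarilyEquivalent_of_norm_eq (A := Roe X) _ _ (cyc _)
    (gnsRep ξ (shift f hf) (cyc ξ)) (denseRange_gnsRep_cyc _) ?_
    fun a => (norm_gnsRep_map_cyc hf hs a).symm
  refine Dense.mono ?_ (denseRange_gnsRep_cyc ξ)
  rintro _ ⟨a, rfl⟩
  refine ⟨a * shift f.symm hf.symm, ?_⟩
  change gnsRep ξ _ (gnsRep ξ _ _) = gnsRep ξ _ _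
  rw [← mul_apply_eq_comp, ← map_mul]
  refine gnsRep_cyc_congr ?_
  filter_upwards [hs] with x hx
  rw [map_mul, map_mul, mul_apply_eq_comp, mul_apply_eq_comp, toOp_shift_delta_of_mem f hf hx,
    toOp_shift_delta_of_mem f.symm hf.symm (f.map_source hx), f.left_inv hx]

/-- An equivalence of `π_ξ` with `π_η` yields a nonzero vector of `H_ξ` over `η`. -/
theorem mem_Orb_of_unitarilyEquivalent {ξ η : Ultrafilter X}
    (h : UnitarilyEquivalent (⟨GNSSpace η, gnsRep η, isIrreducible_gnsRep η⟩ : IrrRep (Roe X))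
      ⟨GNSSpace ξ, gnsRep ξ, isIrreducible_gnsRep ξ⟩) : η ∈ Orb ξ := by
  obtain ⟨U, hU⟩ := h
  by_contra hη
  have hmem : U (cyc η) ∈ closure (fiber ξ η : Set (GNSSpace ξ)) := by
    refine mem_closure_fiber fun B hB => ?_
    conv_rhs => rw [← gnsRep_proj_cyc hB]
    exact (hU _ _).symm
  rw [fiber_eq_bot hη, Submodule.bot_coe, closure_singleton, Set.mem_singleton_iff] at hmem
  exact cyc_ne_zero η (U.map_eq_zero_iff.mp hmem)

/-! ### Kernels, orbit closures and the hull-kernel topology -/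

/-- As the vectors `π_ξ(v_f)Ω` are total and induce the states `φ_η`, `η ∈ Orb(ξ)`, they detect the
kernel of `π_ξ`. -/
theorem mem_ker_gnsRep_iff {ξ : Ultrafilter X} {a : Roe X} :
    a ∈ RingHom.ker (gnsRep ξ) ↔ ∀ η ∈ Orb ξ, gnsRep η a (cyc η) = 0 := by
  rw [RingHom.mem_ker]
  constructor
  · rintro ha _ ⟨f, hf, hs, rfl⟩
    rw [← norm_eq_zero, norm_gnsRep_map_cyc hf hs, ha, zero_apply, norm_zero]
  · intro ha
    have h : (gnsRep ξ a : GNSSpace ξ → GNSSpace ξ) = (0 : GNSSpace ξ →L[ℂ] GNSSpace ξ) := by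
      refine Continuous.ext_on (dense_span_shiftVectors ξ) (gnsRep ξ a).continuous
        (ContinuousLinearMap.continuous _) fun w hw => ?_
      refine LinearMap.eqOn_span (f := (gnsRep ξ a).toLinearMap) (g := 0) ?_ hw
      rintro _ ⟨f, hf, rfl⟩
      change gnsRep ξ a _ = 0
      by_cases hs : f.source ∈ ξ
      · rw [← norm_eq_zero, ← norm_gnsRep_map_cyc hf hs, ha _ ⟨f, hf, hs, rfl⟩, norm_zero]
      · rw [gnsRep_shift_cyc_of_notMem hf hs, map_zero]
    exact DFunLike.coe_injective h

/-- The function `ξ ↦ ‖π_ξ(a)Ω‖` is the extension of `x ↦ ‖a δ_x‖` to `βX`, so it is continuous. -/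
theorem isClosed_setOf_gnsRep_cyc_eq_zero (a : Roe X) :
    IsClosed {ξ : Ultrafilter X | gnsRep ξ a (cyc ξ) = 0} := by
  rw [← isOpen_compl_iff, isOpen_iff_forall_mem_open]
  intro ξ hξ
  have hpos : 0 < ‖gnsRep ξ a (cyc ξ)‖ := norm_pos_iff.mpr hξ
  obtain ⟨c, hc0, hc⟩ := exists_between hpos
  refine ⟨{η | {x | c < ‖Roe.toOp a (delta x)‖} ∈ η}, fun η hη h0 => ?_,
    ultrafilter_isOpen_basic _, (tendsto_norm_toOp_delta ξ a).eventually_const_lt hc⟩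
  have hle : c ≤ ‖gnsRep η a (cyc η)‖ := by
    refine ge_of_tendsto (tendsto_norm_toOp_delta η a) ?_
    filter_upwards [hη] with x hx using hx.le
  rw [h0, norm_zero] at hle
  exact absurd hle (not_le.mpr hc0)

theorem closure_Orb_subset {ξ η : Ultrafilter X} (h : η ∈ closure (Orb ξ)) :
    closure (Orb η) ⊆ closure (Orb ξ) := by
  refine closure_minimal ?_ isClosed_closure
  rintro _ ⟨f, hf, hs, rfl⟩
  rw [ultrafilterBasis_is_basis.mem_closure_iff] at h ⊢
  rintro _ ⟨B, rfl⟩ hB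
  obtain ⟨ζ, hζ, hζ'⟩ := h _ ⟨f.source ∩ f ⁻¹' B, rfl⟩
    (Filter.inter_mem hs (Ultrafilter.mem_map.mp hB))
  exact ⟨ζ.map f, Ultrafilter.mem_map.mpr
    (Filter.mem_of_superset (f := (ζ : Filter X)) hζ Set.inter_subset_right),
    mem_Orb_trans hζ' ⟨f, hf,
      Filter.mem_of_superset (Ultrafilter.mem_coe.mpr hζ) Set.inter_subset_left, rfl⟩⟩

/-- A closed invariant set of ultrafilters is determined by the intersection of its kernels: for `ξ`
outside it there is `B ∈ ξ` that belongs to none of its points, and then `χ_B` is in all the kernels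
of the set while `π_ξ(χ_B)Ω = Ω`. -/
theorem mem_iff_of_isClosed_of_invariant {C : Set (Ultrafilter X)} (hC : IsClosed C)
    (hinv : ∀ ξ ∈ C, Orb ξ ⊆ C) {ξ : Ultrafilter X} :
    ξ ∈ C ↔ ⨅ η ∈ C, RingHom.ker (gnsRep η) ≤ RingHom.ker (gnsRep ξ) := by
  refine ⟨fun h => iInf₂_le ξ h, fun h => ?_⟩
  by_contra hξ
  obtain ⟨_, ⟨B, rfl⟩, hB, hBC⟩ :=
    ultrafilterBasis_is_basis.isOpen_iff.mp hC.isOpen_compl ξ hξ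
  have hmem : proj B ∈ ⨅ η ∈ C, RingHom.ker (gnsRep η) := by
    simp only [Submodule.mem_iInf]
    intro η hη
    rw [mem_ker_gnsRep_iff]
    intro ζ hζ
    refine gnsRep_cyc_eq_zero ?_
    filter_upwards [Ultrafilter.compl_mem_iff_notMem.mpr fun hB' => hBC hB' (hinv η hη hζ)]
      with x hx
    exact toOp_proj_delta_of_notMem hx
  have h0 := mem_ker_gnsRep_iff.mp (h hmem) ξ (mem_Orb_self ξ)
  rw [gnsRep_proj_cyc hB] at h0
  exact cyc_ne_zero ξ h0

theorem ker_gnsRep_le_iff {ξ η : Ultrafilter X} :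
    RingHom.ker (gnsRep ξ) ≤ RingHom.ker (gnsRep η) ↔ η ∈ closure (Orb ξ) := by
  constructor
  · intro h
    refine (mem_iff_of_isClosed_of_invariant isClosed_closure
      fun ζ hζ => subset_closure.trans (closure_Orb_subset hζ)).mpr ?_
    exact (iInf₂_le ξ (subset_closure (mem_Orb_self ξ))).trans h
  · intro h a ha
    rw [mem_ker_gnsRep_iff] at ha ⊢
    intro ζ hζ
    exact closure_minimal (fun θ hθ => ha θ hθ) (isClosed_setOf_gnsRep_cyc_eq_zero a)
      (closure_Orb_subset h (subset_closure hζ))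

theorem ker_gnsRep_eq_iff {ξ η : Ultrafilter X} :
    RingHom.ker (gnsRep ξ) = RingHom.ker (gnsRep η) ↔ closure (Orb ξ) = closure (Orb η) := by
  rw [le_antisymm_iff, ker_gnsRep_le_iff, ker_gnsRep_le_iff]
  constructor
  · rintro ⟨h1, h2⟩
    exact (closure_Orb_subset h2).antisymm (closure_Orb_subset h1)
  · intro h
    exact ⟨h ▸ subset_closure (mem_Orb_self η), h ▸ subset_closure (mem_Orb_self ξ)⟩

/-- The point `ker π_ξ` of the primitive ideal space. -/
noncomputable def primAt (ξ : Ultrafilter X) : Prim (Roe X) :=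
  ⟨RingHom.ker (gnsRep ξ), ⟨GNSSpace ξ, gnsRep ξ, isIrreducible_gnsRep ξ⟩, rfl⟩

/-- The preimage of the hull of `R` consists of the `ξ` with `π_ξ(a)Ω = 0` for all `a ∈ ⋂ R`, as
`⋂ R` is also a right ideal. -/
theorem continuous_primAt : Continuous (primAt (X := X)) := by
  refine continuous_generateFrom_iff.mpr ?_
  rintro _ ⟨R, rfl⟩
  rw [Set.preimage_compl, isOpen_compl_iff]
  have h : primAt ⁻¹' hull R =
      ⋂ a ∈ sInf (Subtype.val '' R), {ξ : Ultrafilter X | gnsRep ξ a (cyc ξ) = 0} := by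
    ext ξ
    simp only [Set.mem_iInter]
    constructor
    · intro hξ a ha
      exact mem_ker_gnsRep_iff.mp (hξ ha) ξ (mem_Orb_self ξ)
    · intro hξ a ha
      refine RingHom.mem_ker.mpr (DFunLike.coe_injective ?_)
      refine DenseRange.equalizer (denseRange_gnsRep_cyc ξ) (gnsRep ξ a).continuous
        (ContinuousLinearMap.continuous _) (funext fun b => ?_)
      change gnsRep ξ a (gnsRep ξ b (cyc ξ)) = 0
      rw [← mul_apply_eq_comp, ← map_mul]
      refine hξ (a * b) ?_
      rw [Submodule.mem_sInf] at ha ⊢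
      rintro _ ⟨J, hJ, rfl⟩
      obtain ⟨ρ, hρ⟩ := J.2
      have hJa := ha _ ⟨J, hJ, rfl⟩
      rw [← hρ, RingHom.mem_ker] at hJa ⊢
      rw [map_mul, hJa, zero_mul]
  rw [h]
  exact isClosed_biInter fun a _ => isClosed_setOf_gnsRep_cyc_eq_zero a

theorem isClosed_hull {A : Type u} [CStarAlgebra A] (R : Set (Prim A)) : IsClosed (hull R) :=
  ⟨TopologicalSpace.isOpen_generateFrom_of_mem ⟨R, rfl⟩⟩

/-- A quotient of `βX` by a relation coarser than orbit equivalence carries the topology induced by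
`ξ ↦ ker π_ξ`, since closed invariant subsets of `βX` are preimages of hulls. -/
theorem isInducing_of_primAt {s : Setoid (Ultrafilter X)} (hs : ∀ ξ, ∀ η ∈ Orb ξ, s.r ξ η)
    {g : Quotient s → Prim (Roe X)} (hg : ∀ ξ, g (Quotient.mk s ξ) = primAt ξ) :
    IsInducing g := by
  have hgc : Continuous g := by
    refine isQuotientMap_quotient_mk'.continuous_iff.mpr ?_
    exact continuous_primAt.congr fun ξ => (hg ξ).symm
  refine ⟨le_antisymm hgc.le_induced fun U hU => ?_⟩
  let C : Set (Ultrafilter X) := {ξ | Quotient.mk s ξ ∉ U}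
  have hC : IsClosed C := hU.isClosed_compl.preimage continuous_quotient_mk'
  have hCinv : ∀ ξ ∈ C, Orb ξ ⊆ C := fun ξ hξ η hη => by
    have h : Quotient.mk s ξ = Quotient.mk s η := Quotient.sound (hs ξ η hη)
    change Quotient.mk s η ∉ U
    rwa [← h]
  refine isOpen_induced_iff.mpr ⟨(hull (primAt '' C))ᶜ, (isClosed_hull _).isOpen_compl, ?_⟩
  have hinf : sInf ((fun J : Prim (Roe X) => J.1) '' (primAt '' C)) =
      ⨅ η ∈ C, RingHom.ker (gnsRep η) := sInf_image.trans iInf_image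
  ext q
  obtain ⟨ξ, rfl⟩ := Quotient.exists_rep q
  have h : primAt ξ ∈ hull (primAt '' C) ↔ ξ ∈ C := by
    rw [mem_iff_of_isClosed_of_invariant hC hCinv, ← hinf]
    rfl
  rw [Set.mem_preimage, hg, Set.mem_compl_iff, h]
  exact not_not

end

end UniformRoe

theorem mainTheorem9 {X : Type u} [MetricSpace X] (hX : UniformRoe.IsULF X) :
    ∃ hirr : ∀ ξ : Ultrafilter X, UniformRoe.IsIrreducible (UniformRoe.gnsRep ξ),
      (∃ Ψ : UniformRoe.OrbSpace X → UniformRoe.Irr (UniformRoe.Roe X),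
        (∀ ξ : Ultrafilter X, Ψ (UniformRoe.OrbSpace.mk ξ) =
          UniformRoe.Irr.mk (UniformRoe.gnsRep ξ) (hirr ξ)) ∧
        Topology.IsEmbedding Ψ) ∧
      (∃ Φ : UniformRoe.QOrbSpace X → UniformRoe.Prim (UniformRoe.Roe X),
        (∀ ξ : Ultrafilter X, (Φ (UniformRoe.QOrbSpace.mk ξ)).1 =
          RingHom.ker (UniformRoe.gnsRep ξ)) ∧
        Topology.IsEmbedding Φ) := by
  refine ⟨UniformRoe.isIrreducible_gnsRep, ?_, ?_⟩
  · let Ψ : UniformRoe.OrbSpace X → UniformRoe.Irr (UniformRoe.Roe X) :=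
      Quotient.lift (fun ξ => UniformRoe.Irr.mk (UniformRoe.gnsRep ξ)
        (UniformRoe.isIrreducible_gnsRep ξ)) fun ξ η h =>
          Quotient.sound (UniformRoe.unitarilyEquivalent_of_mem_Orb (UniformRoe.mem_Orb_symm h))
    refine ⟨Ψ, fun ξ => rfl, ?_, ?_⟩
    · have hker : IsInducing (UniformRoe.Irr.ker (A := UniformRoe.Roe X)) := ⟨rfl⟩
      rw [← hker.of_comp_iff]
      exact UniformRoe.isInducing_of_primAt (fun ξ η h => h) fun ξ => rfl
    · intro p q
      refine Quotient.inductionOn₂ p q fun ξ η h => ?_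
      exact Quotient.sound (UniformRoe.mem_Orb_symm
        (UniformRoe.mem_Orb_of_unitarilyEquivalent (Quotient.exact h)))
  · let Φ : UniformRoe.QOrbSpace X → UniformRoe.Prim (UniformRoe.Roe X) :=
      Quotient.lift UniformRoe.primAt fun ξ η h =>
        Subtype.ext (UniformRoe.ker_gnsRep_eq_iff.mpr h)
    refine ⟨Φ, fun ξ => rfl, ?_, ?_⟩
    · refine UniformRoe.isInducing_of_primAt (fun ξ η h => ?_) fun ξ => rfl
      exact (UniformRoe.closure_Orb_subset
        (subset_closure (UniformRoe.mem_Orb_symm h))).antisymm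
          (UniformRoe.closure_Orb_subset (subset_closure h))
    · intro p q
      refine Quotient.inductionOn₂ p q fun ξ η h => ?_
      exact Quotient.sound (UniformRoe.ker_gnsRep_eq_iff.mp (congrArg Subtype.val h))
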